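/- Let $G$ be a finitely generated virtually free group (that is, $G$ has a free subgroup of finite index) and let $H$ be a finitely generated subgroup of $G$. Let $X\subseteq G$ be any finite generating set of $G$ that is closed under inversion, let $X^*$ be the set of finite words over $X$, and let $\phi\colon X^*\to G$ be the natural map sending a word to the product of its letters in $G$. Then the generalised word problem $\mathrm{GWP}(G,H,X)=\phi^{-1}(H)\subseteq X^*$ is a deterministic context-free language, i.e. it is accepted, by final state, by a deterministic pushdown automaton. -/

import Mathlib

universe u

/-- A group is virtually free if it has a free subgroup of finite index. -/
def IsVirtuallyFree (G : Type u) [Group G] : Prop :=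
  ∃ F : Subgroup G, F.FiniteIndex ∧ IsFreeGroup F

/-- A deterministic pushdown automaton with input alphabet `α`, states `Q` and stack alphabet `Γ`.
The partial transition function sends a state, an input letter (`none` for a move that reads no
input) and the popped top stack symbol to the next state and the string that is pushed (its head
becomes the new top). A state and a top symbol that allow a move without input allow no other. -/
structure DPDA (α : Type u) (Q Γ : Type) where
  start : Q
  bottom : Γ
  final : Set Q
  trans : Q → Option α → Γ → Option (Q × List Γ)
  deterministic : ∀ (q : Q) (Z : Γ),
    trans q none Z ≠ none → ∀ a : α, trans q (some a) Z = none

namespace DPDA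

/-- One move between configurations (state, unread input, stack with its top first). -/
inductive Step {α : Type u} {Q Γ : Type} (M : DPDA α Q Γ) :
    Q × List α × List Γ → Q × List α × List Γ → Prop
  | read {q p : Q} {a : α} {w : List α} {Z : Γ} {γ β : List Γ}
      (h : M.trans q (some a) Z = some (p, γ)) : Step M (q, a :: w, Z :: β) (p, w, γ ++ β)
  | silent {q p : Q} {w : List α} {Z : Γ} {γ β : List Γ}
      (h : M.trans q none Z = some (p, γ)) : Step M (q, w, Z :: β) (p, w, γ ++ β)

/-- The language accepted by final state: some computation from the start state with only the
bottom symbol on the stack reads the whole input and is then in a final state. -/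
def accepts {α : Type u} {Q Γ : Type} (M : DPDA α Q Γ) : Language α :=
  {w | ∃ q ∈ M.final, ∃ β : List Γ,
    Relation.ReflTransGen M.Step (M.start, w, [M.bottom]) (q, [], β)}

end DPDA

/-- A language over a finite alphabet is deterministic context-free if it is accepted by a
deterministic pushdown automaton with finitely many states and stack symbols. -/
def IsDeterministicContextFree {α : Type u} [Finite α] (L : Language α) : Prop :=
  ∃ (Q Γ : Type) (_ : Finite Q) (_ : Finite Γ) (M : DPDA α Q Γ), M.accepts = L

/-- The generalised word problem: all words over `X` that represent an element of `H`. -/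
def GWP {G : Type u} [Group G] (H : Subgroup G) (X : Finset G) : Language X :=
  {w | (w.map (fun x : X => (x : G))).prod ∈ H}

namespace FreeGroup

/-! Every element of `G` is some `τ i * ι f`, with `ι` a finite-index embedding of a free group of
finite rank and finitely many `τ i`. The automaton keeps the inverse of the prefix read in this
form: `i` in the state, the reduced word of `f` on the stack. Reading `x` multiplies by `x⁻¹` on the
left, so `f` gains one of finitely many left factors and the work happens at the top of the stack.

Membership in `H` says that `f` carries the base point of `G ⧸ H` to the coset of `(τ i)⁻¹`. The
stabilizer of the base point is isomorphic to a finite-index subgroup of `H`, hence finitely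
generated, so reduced words with this effect stay in a finite part of the Schreier graph
(`exists_finite_suffixesIn`). A finite automaton reading the stack upwards therefore decides
membership (`exists_automaton_smul_eq`); stack symbols store its states, so that a pop can restore
them. -/

theorem finite_of_fg {A : Type*} [Group.FG (FreeGroup A)] : Finite A := by
  classical
  obtain ⟨S, hS, hfin⟩ := Group.fg_iff.1 (inferInstance : Group.FG (FreeGroup A))
  have := hfin.to_subtype
  let φ (a : A) : FreeGroup A →* Multiplicative (ZMod 2) :=
    lift (Pi.mulSingle a (Multiplicative.ofAdd 1))
  -- The maps `φ a` count the exponent of `a` mod 2; they are distinct and determined by their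
  -- values on the finite set `S`.
  refine Finite.of_injective (fun a (s : S) => φ a s) fun a b hab => ?_
  have h : φ a = φ b :=
    MonoidHom.eq_of_eqOn_dense hS fun s hs => congrFun hab ⟨s, hs⟩
  by_contra hne
  have h1 := DFunLike.congr_fun h (of a)
  simp [φ, Pi.mulSingle_eq_of_ne hne] at h1

/-! ### Reduced words and paths in Schreier graphs -/

section Word

variable {A : Type*} [DecidableEq A]

theorem toWord_mk_singleton_mul (a : A × Bool) (f : FreeGroup A) :
    toWord (mk [a] * f) = reduce (a :: toWord f) := by
  conv_lhs => rw [← mk_toWord (x := f), mul_mk, toWord_mk]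
  rfl

theorem toWord_letter_mul_of_cancel {a : A × Bool} {f : FreeGroup A} {l : List (A × Bool)}
    (h : toWord f = (a.1, !a.2) :: l) : toWord (mk [a] * f) = l := by
  rw [toWord_mk_singleton_mul, reduce.cons, reduce_toWord, h]
  simp

theorem toWord_letter_mul_of_ne {a : A × Bool} {f : FreeGroup A}
    (h : ∀ l, toWord f ≠ (a.1, !a.2) :: l) : toWord (mk [a] * f) = a :: toWord f := by
  rw [toWord_mk_singleton_mul, reduce.cons, reduce_toWord]
  rcases hf : toWord f with _ | ⟨b, l⟩
  · rfl
  · rw [hf] at h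
    dsimp only
    rw [if_neg]
    rintro ⟨h1, h2⟩
    apply h l
    obtain ⟨b1, b2⟩ := b
    simp_all

/-- All suffixes of the reduced word of `f` move the point `x` into the set `C`. -/
def SuffixesIn {Ω : Type*} [MulAction (FreeGroup A) Ω] (C : Set Ω) (x : Ω) (f : FreeGroup A) :
    Prop :=
  ∀ l, l <:+ toWord f → mk l • x ∈ C

namespace SuffixesIn

variable {Ω : Type*} [MulAction (FreeGroup A) Ω] {C : Set Ω} {x : Ω}

/-- Cancellation leaves a suffix of the old word; otherwise the only new suffix is the whole word.
-/
theorem letter_mul {a : A × Bool} {f : FreeGroup A} (hf : SuffixesIn C x f)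
    (ha : (mk [a] * f) • x ∈ C) : SuffixesIn C x (mk [a] * f) := by
  intro l hl
  by_cases h : ∃ m, toWord f = (a.1, !a.2) :: m
  · obtain ⟨m, hm⟩ := h
    rw [toWord_letter_mul_of_cancel hm] at hl
    exact hf l (hm ▸ hl.trans (List.suffix_cons _ _))
  · push Not at h
    have hw := toWord_letter_mul_of_ne h
    rw [hw, List.suffix_cons_iff] at hl
    rcases hl with rfl | hl
    · rwa [← hw, mk_toWord]
    · exact hf l hl

/-- Multiply `s` on the left by the letters of `f` one at a time: as `s` fixes `x`, each partial
product moves `x` to where a suffix of `f` does. -/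
theorem mul_of_smul_eq {f s : FreeGroup A} (hf : SuffixesIn C x f) (hs : SuffixesIn C x s)
    (hx : s • x = x) : SuffixesIn C x (f * s) := by
  have key : ∀ l, l <:+ toWord f → SuffixesIn C x (mk l * s) := by
    intro l
    induction l with
    | nil => intro _; simpa [← one_eq_mk] using hs
    | cons a l ih =>
      intro hl
      have : mk (a :: l) * s = mk [a] * (mk l * s) := by
        rw [← mul_assoc, mul_mk]; rfl
      rw [this]
      refine (ih ((List.suffix_cons _ _).trans hl)).letter_mul ?_
      rw [← this, mul_smul, hx]
      exact hf _ hl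
  have h := key _ List.suffix_rfl
  rwa [mk_toWord] at h

end SuffixesIn

/-- Any such `f` is a chosen representative of the point `f • x` times a stabilizer element, so `C`
need only contain the paths of the representatives and of the stabilizer generators and their
inverses. -/
theorem exists_finite_suffixesIn {Ω : Type*} [MulAction (FreeGroup A) Ω] (x : Ω)
    (hK : (MulAction.stabilizer (FreeGroup A) x).FG) {O : Set Ω} (hO : O.Finite) :
    ∃ C : Set Ω, C.Finite ∧ ∀ f : FreeGroup A, f • x ∈ O → SuffixesIn C x f := by
  obtain ⟨S, hS, hSfin⟩ := (Subgroup.fg_iff _).1 hK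
  have hr : ∀ o : Ω, ∃ f : FreeGroup A, (∃ g : FreeGroup A, g • x = o) → f • x = o := by
    intro o
    by_cases h : ∃ g : FreeGroup A, g • x = o
    · exact ⟨h.choose, fun _ => h.choose_spec⟩
    · exact ⟨1, fun h' => absurd h' h⟩
  choose r hr using hr
  let W : Set (FreeGroup A) := S ∪ S⁻¹ ∪ {1} ∪ r '' O
  have hW : W.Finite := ((hSfin.union hSfin.inv).union (Set.finite_singleton 1)).union (hO.image r)
  let C : Set Ω := ⋃ f ∈ W, (fun l => mk l • x) '' {l | l <:+ toWord f}
  have hC : ∀ f ∈ W, SuffixesIn C x f := fun f hf l hl =>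
    Set.mem_biUnion hf ⟨l, hl, rfl⟩
  have hSx : ∀ s ∈ S, s • x = x := fun s hs => by
    have : s ∈ MulAction.stabilizer (FreeGroup A) x := hS ▸ Subgroup.subset_closure hs
    exact this
  have hstab : ∀ k ∈ Subgroup.closure S, SuffixesIn C x k := by
    intro k hk
    induction hk using Subgroup.closure_induction_right with
    | one => exact hC 1 (by simp [W])
    | mul_right f hf s hs ih =>
      exact ih.mul_of_smul_eq (hC s (by simp [W, hs])) (hSx s hs)
    | mul_inv_cancel f hf s hs ih =>
      refine ih.mul_of_smul_eq (hC _ (by simp [W, hs])) ?_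
      rw [inv_smul_eq_iff, hSx s hs]
  refine ⟨C, hW.biUnion fun f _ => Set.Finite.image _ ?_, fun f hf => ?_⟩
  · refine (List.finite_toSet (toWord f).tails).subset fun l hl => ?_
    simpa using hl
  · have h1 : r (f • x) • x = f • x := hr _ ⟨f, rfl⟩
    have h2 : (r (f • x))⁻¹ * f ∈ MulAction.stabilizer (FreeGroup A) x := by
      rw [MulAction.mem_stabilizer_iff, mul_smul, inv_smul_eq_iff, h1]
    have h3 := (hC (r (f • x)) (Or.inr ⟨_, hf, rfl⟩)).mul_of_smul_eq (hstab _ (hS ▸ h2)) h2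
    simpa using h3

/-- Reduced words, read from their last letter, that send a point with finitely generated
stabilizer into a given finite family of points are recognized by a finite automaton. -/
theorem exists_automaton_smul_eq {Ω I : Type*} [Finite I] [MulAction (FreeGroup A) Ω] (x : Ω)
    (hK : (MulAction.stabilizer (FreeGroup A) x).FG) (o : I → Ω) :
    ∃ (k : ℕ) (δ : A × Bool → Fin k → Fin k) (d₀ : Fin k) (acc : I → Set (Fin k)),
      ∀ (f : FreeGroup A) (i : I), (toWord f).foldr δ d₀ ∈ acc i ↔ f • x = o i := by
  classical
  obtain ⟨C, hC, h⟩ := exists_finite_suffixesIn x hK (Set.finite_range o)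
  have := hC.to_subtype
  obtain ⟨k, ⟨e⟩⟩ := Finite.exists_equiv_fin (Option C)
  -- The state `none` is a sink, entered once the path leaves `C`.
  let lift (y : Ω) : Option C := if hy : y ∈ C then some ⟨y, hy⟩ else none
  let δ (a : A × Bool) (d : Option C) : Option C := d.bind fun y => lift (mk [a] • (y : Ω))
  have hlift : ∀ y c, lift y = some c ↔ y = c := by
    intro y c
    by_cases hy : y ∈ C
    · simp [lift, hy, Subtype.ext_iff]
    · simp only [lift, hy, dite_false, reduceCtorEq, false_iff]
      rintro rfl
      exact hy c.2
  have hrun : ∀ (l : List (A × Bool)) (c : C), l.foldr δ (lift x) = some c ↔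
      mk l • x = c ∧ ∀ m, m <:+ l → mk m • x ∈ C := by
    intro l
    induction l with
    | nil =>
      intro c
      simp only [List.foldr_nil, hlift, ← one_eq_mk, one_smul, List.suffix_nil]
      refine ⟨fun hx => ⟨hx, ?_⟩, fun hx => hx.1⟩
      rintro m rfl
      rw [← one_eq_mk, one_smul, hx]
      exact c.2
    | cons a l ih =>
      intro c
      have hal : mk (a :: l) • x = mk [a] • mk l • x := by
        rw [← mul_smul, mul_mk]; rfl
      simp only [List.foldr_cons]
      change (l.foldr δ (lift x)).bind _ = _ ↔ _
      rw [Option.bind_eq_some_iff]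
      constructor
      · rintro ⟨y, hy, hyc⟩
        rw [hlift] at hyc
        obtain ⟨h1, h2⟩ := (ih y).1 hy
        rw [hal, h1]
        refine ⟨hyc, fun m hm => ?_⟩
        rw [List.suffix_cons_iff] at hm
        rcases hm with rfl | hm
        · rw [hal, h1, hyc]; exact c.2
        · exact h2 m hm
      · rintro ⟨h1, h2⟩
        refine ⟨⟨mk l • x, h2 l (List.suffix_cons _ _)⟩, (ih _).2 ⟨rfl, fun m hm =>
          h2 m (hm.trans (List.suffix_cons _ _))⟩, ?_⟩
        rw [hlift, ← hal, h1]
  have hconj : ∀ l : List (A × Bool),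
      l.foldr (fun a d => e (δ a (e.symm d))) (e (lift x)) = e (l.foldr δ (lift x)) := by
    intro l
    induction l with
    | nil => rfl
    | cons a l ih => simp [ih]
  refine ⟨k, fun a d => e (δ a (e.symm d)), e (lift x),
    fun i => {d | ∃ c : C, e.symm d = some c ∧ (c : Ω) = o i}, fun f i => ?_⟩
  rw [hconj]
  simp only [Set.mem_ofPred_eq, Equiv.symm_apply_apply, hrun, mk_toWord]
  constructor
  · rintro ⟨c, ⟨h1, -⟩, h2⟩
    rw [h1, h2]
  · intro hf
    have hs := h f ⟨i, hf.symm⟩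
    have hmem := hs _ List.suffix_rfl
    rw [mk_toWord] at hmem
    exact ⟨⟨f • x, hmem⟩, ⟨rfl, hs⟩, hf⟩

end Word

end FreeGroup

/-! ### Finite-index free subgroups and the pushdown automaton -/

open FreeGroup

/-- A finitely generated virtually free group contains a finitely generated free group, embedded
with finite index. -/
theorem IsVirtuallyFree.exists_embedding {G : Type u} [Group G] [Group.FG G]
    (hG : IsVirtuallyFree G) :
    ∃ (n : ℕ) (ι : FreeGroup (Fin n) →* G), Function.Injective ι ∧ ι.range.FiniteIndex := by
  obtain ⟨F, hF, hfree⟩ := hG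
  have : Group.FG F := Subgroup.fg_of_index_ne_zero F
  let e := IsFreeGroup.toFreeGroup F
  have : Group.FG (FreeGroup (IsFreeGroup.Generators F)) :=
    Group.fg_of_surjective (f := e.toMonoidHom) e.surjective
  have : Finite (IsFreeGroup.Generators F) := finite_of_fg
  obtain ⟨n, ⟨e'⟩⟩ := Finite.exists_equiv_fin (IsFreeGroup.Generators F)
  let E : FreeGroup (Fin n) ≃* F := (freeGroupCongr e').symm.trans e.symm
  refine ⟨n, F.subtype.comp E.toMonoidHom, F.subtype_injective.comp E.injective, ?_⟩
  rw [MonoidHom.range_comp, MonoidHom.range_eq_top.2 E.surjective, ← MonoidHom.range_eq_map,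
    Subgroup.range_subtype]
  exact hF

theorem Subgroup.FG.comap_of_injective {G K : Type*} [Group G] [Group K] {H : Subgroup G}
    (hH : H.FG) {ι : K →* G} (hι : Function.Injective ι) [ι.range.FiniteIndex] :
    (H.comap ι).FG := by
  have : Group.FG H := (Group.fg_iff_subgroup_fg H).2 hH
  have h1 : Group.FG (ι.range.subgroupOf H) := Subgroup.fg_of_index_ne_zero _
  have h2 : Group.FG ((ι.range.subgroupOf H).map H.subtype) :=
    Group.fg_of_surjective
      (f := ((ι.range.subgroupOf H).equivMapOfInjective H.subtype
        H.subtype_injective).toMonoidHom) (MulEquiv.surjective _)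
  rw [Subgroup.subgroupOf_map_subtype, ← Subgroup.map_comap_eq] at h2
  rw [← Group.fg_iff_subgroup_fg]
  exact Group.fg_of_surjective
    (f := ((H.comap ι).equivMapOfInjective ι hι).symm.toMonoidHom) (MulEquiv.surjective _)

/-- Finitely many elements `τ i` represent the left cosets of a range of finite index. -/
theorem Subgroup.FiniteIndex.exists_transversal {G K : Type*} [Group G] [Group K] (ι : K →* G)
    [ι.range.FiniteIndex] : ∃ (m : ℕ) (τ : Fin m → G), ∀ g, ∃ i f, g = τ i * ι f := by
  obtain ⟨m, ⟨e⟩⟩ := Finite.exists_equiv_fin (G ⧸ ι.range)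
  refine ⟨m, fun i => (e.symm i).out, fun g => ?_⟩
  obtain ⟨⟨_, f, rfl⟩, hf⟩ := QuotientGroup.mk_out_eq_mul ι.range g
  refine ⟨e g, f⁻¹, ?_⟩
  simp [hf]

/-- Moves are determined by the state, the unread input and the stack. -/
theorem DPDA.Step.unique {α : Type u} {Q Γ : Type} {M : DPDA α Q Γ}
    {c c₁ c₂ : Q × List α × List Γ} (h₁ : M.Step c c₁) (h₂ : M.Step c c₂) : c₁ = c₂ := by
  cases h₁ with
  | read h =>
    cases h₂ with
    | read h' => rw [h] at h'; cases h'; rfl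
    | silent h' =>
      have := M.deterministic _ _ (by rw [h']; simp)
      rw [this] at h; cases h
  | silent h =>
    cases h₂ with
    | read h' =>
      have := M.deterministic _ _ (by rw [h]; simp)
      rw [this] at h'; cases h'
    | silent h' => rw [h] at h'; cases h'; rfl

/-- A finite coset table together with a finite automaton over the letters of a free group. Reading
`x` in coset `i` leads to coset `next x i` and emits the letters `emit x i`; the automaton `δ`, `d₀`,
`acc` tests the reduced words that represent an element of the subgroup in each coset. -/
structure CosetMachine (X : Type u) (n : ℕ) where
  m : ℕ
  k : ℕ
  bound : ℕ
  next : X → Fin m → Fin m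
  emit : X → Fin m → List (Fin n × Bool)
  length_emit_le : ∀ x i, (emit x i).length ≤ bound
  δ : Fin n × Bool → Fin k → Fin k
  d₀ : Fin k
  acc : Fin m → Set (Fin k)
  i₀ : Fin m
  p₀ : List (Fin n × Bool)
  length_p₀_le : p₀.length ≤ bound

namespace CosetMachine

variable {X : Type u} {n : ℕ} (A : CosetMachine X n)

/-- The states: a coset, the letters still to be multiplied to the stack, and the state of the
automaton that has read the stack. -/
abbrev State : Type :=
  Fin A.m × {p : List (Fin n × Bool) // p.length ≤ A.bound} × Fin A.k

/-- The stack symbols: a letter with the state of the automaton below it, or the bottom. -/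
abbrev Symbol : Type := Option ((Fin n × Bool) × Fin A.k)

open Classical in
/-- The transitions: with letters pending, multiply the first one to the stack; otherwise read. -/
noncomputable def trans : A.State → Option X → A.Symbol → Option (A.State × List A.Symbol)
  | (i, ⟨[], _⟩, d), some x, Z => some ((A.next x i, ⟨A.emit x i, A.length_emit_le x i⟩, d), [Z])
  | (i, ⟨a :: p, h⟩, d), none, Z =>
    -- The popped symbol holds the automaton state for the stack below it.
    if hZ : ∃ d', Z = some ((a.1, !a.2), d') then
      some ((i, ⟨p, (Nat.le_succ _).trans h⟩, hZ.choose), [])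
    else some ((i, ⟨p, (Nat.le_succ _).trans h⟩, A.δ a d), [some (a, d), Z])
  | _, _, _ => none

/-- The pushdown automaton that keeps a reduced word on its stack. -/
noncomputable def toDPDA : DPDA X A.State A.Symbol where
  start := (A.i₀, ⟨A.p₀, A.length_p₀_le⟩, A.d₀)
  bottom := none
  final := {q | q.2.1.1 = [] ∧ q.2.2 ∈ A.acc q.1}
  trans := A.trans
  deterministic := by
    rintro ⟨i, ⟨_ | ⟨a, p⟩, h⟩, d⟩ Z hne x
    · exact absurd rfl hne
    · rfl

/-- The state of the automaton after reading a reduced word from its last letter. -/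
def run (l : List (Fin n × Bool)) : Fin A.k := l.foldr A.δ A.d₀

/-- The stack that represents a reduced word, the first letter on top. -/
def stack : List (Fin n × Bool) → List A.Symbol
  | [] => [none]
  | a :: l => some (a, A.run l) :: stack l

theorem stack_ne_nil (l : List (Fin n × Bool)) : ∃ Z β, A.stack l = Z :: β := by
  cases l <;> exact ⟨_, _, rfl⟩

theorem step_silent (i : Fin A.m) (a : Fin n × Bool) (p : List (Fin n × Bool))
    (h : (a :: p).length ≤ A.bound) (w : List X) (f : FreeGroup (Fin n)) :
    A.toDPDA.Step ((i, ⟨a :: p, h⟩, A.run f.toWord), w, A.stack f.toWord)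
      ((i, ⟨p, (Nat.le_succ _).trans h⟩, A.run (FreeGroup.mk [a] * f).toWord), w,
        A.stack (FreeGroup.mk [a] * f).toWord) := by
  by_cases hc : ∃ m, toWord f = (a.1, !a.2) :: m
  · obtain ⟨m, hm⟩ := hc
    rw [toWord_letter_mul_of_cancel hm, hm]
    have hZ : ∃ d', (some ((a.1, !a.2), A.run m) : A.Symbol) = some ((a.1, !a.2), d') := ⟨_, rfl⟩
    have hd : hZ.choose = A.run m := by simp
    refine DPDA.Step.silent (γ := []) ?_
    simp only [toDPDA, trans]
    rw [dif_pos hZ, hd]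
  · push Not at hc
    rw [toWord_letter_mul_of_ne hc]
    obtain ⟨Z, β, hZ⟩ := A.stack_ne_nil f.toWord
    have hn : ¬ ∃ d', Z = some ((a.1, !a.2), d') := by
      rintro ⟨d', rfl⟩
      rcases hf : toWord f with _ | ⟨b, l⟩
      · simp [hf, stack] at hZ
      · rw [hf, stack] at hZ
        simp only [List.cons.injEq, Option.some.injEq, Prod.mk.injEq] at hZ
        exact hc l (hf.trans (by rw [hZ.1.1]))
    have hs : A.stack (a :: toWord f) = [some (a, A.run f.toWord), Z] ++ β := by
      rw [stack, hZ]; rfl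
    rw [hs, hZ]
    refine DPDA.Step.silent ?_
    simp only [toDPDA, trans]
    rw [dif_neg hn]
    rfl

theorem step_read (i : Fin A.m) (h : ([] : List (Fin n × Bool)).length ≤ A.bound) (x : X)
    (w : List X) (f : FreeGroup (Fin n)) :
    A.toDPDA.Step ((i, ⟨[], h⟩, A.run f.toWord), x :: w, A.stack f.toWord)
      ((A.next x i, ⟨A.emit x i, A.length_emit_le x i⟩, A.run f.toWord), w,
        A.stack f.toWord) := by
  obtain ⟨Z, β, hZ⟩ := A.stack_ne_nil f.toWord
  rw [hZ]
  exact DPDA.Step.read (γ := [Z]) rfl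

/-! ### The invariant and correctness -/

section Semantics

variable {A} {G : Type u} [Group G] (ι : FreeGroup (Fin n) →* G) (τ : Fin A.m → G) (v : X → G)

/-- The configuration represents the group element `g`: the coset, the pending letters and the
stack give the inverse of the part of `g` that is already read. -/
def Represents (g : G) (c : A.State × List X × List A.Symbol) : Prop :=
  ∃ (i : Fin A.m) (p : List (Fin n × Bool)) (h : p.length ≤ A.bound) (w : List X)
    (f : FreeGroup (Fin n)),
    c = ((i, ⟨p, h⟩, A.run f.toWord), w, A.stack f.toWord) ∧
      τ i * ι (FreeGroup.mk p.reverse * f) = (w.map v).prod * g⁻¹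

variable {ι τ v}

/-- Pending letters are multiplied on the left, first letter first, so they spell their factor
backwards. -/
theorem mk_reverse_cons_mul (a : Fin n × Bool) (p : List (Fin n × Bool))
    (f : FreeGroup (Fin n)) : FreeGroup.mk (a :: p).reverse * f = FreeGroup.mk p.reverse * (FreeGroup.mk [a] * f) := by
  rw [← mul_assoc, mul_mk, List.reverse_cons]

variable (hstep : ∀ x i, (v x)⁻¹ * τ i = τ (A.next x i) * ι (FreeGroup.mk (A.emit x i).reverse))

include hstep in
theorem Represents.step {g : G} {c c' : A.State × List X × List A.Symbol}
    (hc : Represents ι τ v g c) (h : A.toDPDA.Step c c') : Represents ι τ v g c' := by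
  obtain ⟨i, p, hp, w, f, rfl, hg⟩ := hc
  rcases p with _ | ⟨a, p⟩
  · rcases w with _ | ⟨x, w⟩
    · obtain ⟨Z, β, hZ⟩ := A.stack_ne_nil f.toWord
      rw [hZ] at h
      cases h with
      | silent h => cases h
    · rw [h.unique (A.step_read i hp x w f)]
      refine ⟨_, _, _, _, _, rfl, ?_⟩
      rw [_root_.map_mul, ← mul_assoc, ← hstep]
      have : τ i * ι f = v x * ((w.map v).prod * g⁻¹) := by
        simpa [← one_eq_mk, mul_assoc] using hg
      rw [mul_assoc, this, inv_mul_cancel_left]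
  · rw [h.unique (A.step_silent i a p hp w f)]
    exact ⟨_, _, _, _, _, rfl, by rw [← mk_reverse_cons_mul, hg]⟩

variable (A) in
theorem exists_clear_pending (i : Fin A.m) (p : List (Fin n × Bool)) (h : p.length ≤ A.bound)
    (w : List X) (f : FreeGroup (Fin n)) : ∃ f' : FreeGroup (Fin n),
      Relation.ReflTransGen A.toDPDA.Step ((i, ⟨p, h⟩, A.run f.toWord), w, A.stack f.toWord)
        ((i, ⟨[], Nat.zero_le _⟩, A.run f'.toWord), w, A.stack f'.toWord) := by
  induction p generalizing f with
  | nil => exact ⟨f, .refl⟩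
  | cons a p ih =>
    obtain ⟨f', hf'⟩ := ih ((Nat.le_succ _).trans h) (FreeGroup.mk [a] * f)
    exact ⟨f', .head (A.step_silent i a p h w f) hf'⟩

variable (A) in
theorem exists_read_all (i : Fin A.m) (p : List (Fin n × Bool)) (h : p.length ≤ A.bound)
    (w : List X) (f : FreeGroup (Fin n)) : ∃ (i' : Fin A.m) (f' : FreeGroup (Fin n)),
      Relation.ReflTransGen A.toDPDA.Step ((i, ⟨p, h⟩, A.run f.toWord), w, A.stack f.toWord)
        ((i', ⟨[], Nat.zero_le _⟩, A.run f'.toWord), [], A.stack f'.toWord) := by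
  induction w generalizing i p f with
  | nil => exact ⟨i, A.exists_clear_pending i p h [] f⟩
  | cons x w ih =>
    obtain ⟨f', hf'⟩ := A.exists_clear_pending i p h (x :: w) f
    obtain ⟨i'', f'', h''⟩ := ih (A.next x i) (A.emit x i) (A.length_emit_le x i) f'
    exact ⟨i'', f'', hf'.trans (.head (A.step_read i _ x w f') h'')⟩

theorem mem_accepts_iff {H : Subgroup G}
    (hstep : ∀ x i, (v x)⁻¹ * τ i = τ (A.next x i) * ι (FreeGroup.mk (A.emit x i).reverse))
    (hstart : τ A.i₀ * ι (FreeGroup.mk A.p₀.reverse) = 1)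
    (hacc : ∀ (f : FreeGroup (Fin n)) i, A.run f.toWord ∈ A.acc i ↔ τ i * ι f ∈ H)
    (w : List X) : w ∈ A.toDPDA.accepts ↔ (w.map v).prod ∈ H := by
  have hs : Represents ι τ v (w.map v).prod (A.toDPDA.start, w, [A.toDPDA.bottom]) :=
    ⟨A.i₀, A.p₀, A.length_p₀_le, w, 1, rfl, by simp [hstart]⟩
  have hfin : ∀ q β, Relation.ReflTransGen A.toDPDA.Step
      (A.toDPDA.start, w, [A.toDPDA.bottom]) (q, [], β) → q.2.1.1 = [] →
      (q ∈ A.toDPDA.final ↔ (w.map v).prod ∈ H) := by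
    intro q β h hq
    have hr : Represents ι τ v (w.map v).prod (q, [], β) := by
      generalize (q, ([] : List X), β) = c at h
      induction h with
      | refl => exact hs
      | tail _ h ih => exact ih.step hstep h
    obtain ⟨i, p, hp, w', f, hc, hg⟩ := hr
    simp only [Prod.mk.injEq] at hc
    obtain ⟨rfl, rfl, rfl⟩ := hc
    obtain rfl : p = [] := hq
    have hg' : τ i * ι f = (w.map v).prod⁻¹ := by simpa [← one_eq_mk] using hg
    -- The machine holds the inverse of the input, which lies in `H` exactly when the input does.
    rw [← inv_mem_iff (x := (w.map v).prod), ← hg', ← hacc]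
    exact ⟨fun h => h.2, fun h => ⟨rfl, h⟩⟩
  constructor
  · rintro ⟨q, hq, β, h⟩
    exact (hfin q β h hq.1).1 hq
  · intro hw
    obtain ⟨i, f, h⟩ := A.exists_read_all A.i₀ A.p₀ A.length_p₀_le w 1
    exact ⟨_, (hfin _ _ h rfl).2 hw, _, h⟩

end Semantics

end CosetMachine

theorem theorem3 {G : Type u} [Group G] [Group.FG G] (hG : IsVirtuallyFree G)
    (H : Subgroup G) (hH : H.FG)
    (X : Finset G) (hgen : Subgroup.closure (X : Set G) = ⊤) (hinv : ∀ x ∈ X, x⁻¹ ∈ X) :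
    IsDeterministicContextFree (GWP H X) := by
  obtain ⟨n, ι, hι, hfi⟩ := hG.exists_embedding
  obtain ⟨m, τ, hτ⟩ := Subgroup.FiniteIndex.exists_transversal ι
  have hτ' : ∀ g, ∃ (i : Fin m) (p : List (Fin n × Bool)), g = τ i * ι (mk p.reverse) := by
    intro g
    obtain ⟨i, f, h⟩ := hτ g
    exact ⟨i, f.toWord.reverse, by rw [List.reverse_reverse, mk_toWord, h]⟩
  let _ : MulAction (FreeGroup (Fin n)) (G ⧸ H) := MulAction.compHom _ ι
  have hsmul : ∀ (f : FreeGroup (Fin n)) (c : G ⧸ H), f • c = ι f • c := fun _ _ => rfl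
  have hstab : MulAction.stabilizer (FreeGroup (Fin n)) ((1 : G) : G ⧸ H) = H.comap ι := by
    ext f
    rw [MulAction.mem_stabilizer_iff, hsmul, MulAction.Quotient.smul_coe, eq_comm,
      QuotientGroup.eq]
    simp
  obtain ⟨k, δ, d₀, acc, hacc⟩ := exists_automaton_smul_eq ((1 : G) : G ⧸ H)
    (hstab ▸ hH.comap_of_injective hι) fun i => (((τ i)⁻¹ : G) : G ⧸ H)
  -- The `τ i` need not include `1`, so the run starts with pending letters `p₀` that correct for `τ
  -- i₀`.
  obtain ⟨i₀, p₀, h₀⟩ := hτ' 1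
  choose next emit hstep using fun (x : X) i => hτ' ((x : G)⁻¹ * τ i)
  obtain ⟨N, hN⟩ := (Set.finite_range fun y : X × Fin m => (emit y.1 y.2).length).bddAbove
  let A : CosetMachine X n :=
    { m, k, next, emit, δ, d₀, acc, i₀, p₀
      bound := max N p₀.length
      length_emit_le := fun x i => (hN ⟨(x, i), rfl⟩).trans (le_max_left _ _)
      length_p₀_le := le_max_right _ _ }
  have : Finite {p : List (Fin n × Bool) // p.length ≤ A.bound} :=
    (List.finite_length_le _ _).to_subtype
  refine ⟨A.State, A.Symbol, inferInstance, inferInstance, A.toDPDA, ?_⟩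
  ext w
  refine CosetMachine.mem_accepts_iff (A := A) hstep h₀.symm (fun f i => ?_) w
  refine (hacc f i).trans ?_
  rw [hsmul, MulAction.Quotient.smul_coe, eq_comm, QuotientGroup.eq]
  simp
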